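/- For integers $n,k\ge 1$ let $\mathcal P_{n,k}$ be the set of all real polynomials of the form $P(x)=x^{n+1}R(x)$ with $R$ a real polynomial of degree at most $k-1$. For a real function $f$ on $[0,1]$ put $\|f\|_{[0,1]}=\sup_{x\in[0,1]}|f(x)|$, and for a continuously differentiable $f$ let $V_0^1(f)=\int_0^1|f'(x)|\,dx$ be its total variation on $[0,1]$. **Theorem.** There are absolute constants $c_1>0$ and $c_2>0$ such that for all integers $n\ge1$ and $k\ge1$ $$c_1\left(\frac nk\right)^{1/2}\le \min_{0\ne P\in\mathcal P_{n,k}}\frac{\|P'(x)\sqrt{1-x^2}\|_{[0,1]}}{V_0^1(P)}\le \min_{P\in\mathcal P_{n,k},\,P(1)\ne0}\frac{\|P'(x)\sqrt{1-x^2}\|_{[0,1]}}{|P(1)|}\le c_2\left(\frac nk+1\right)^{1/2},$$ where both minima are attained, and $c_1=1/6$ is a suitable choice. Moreover, both minima equal the infima of the same quotients over those $P\in\mathcal P_{n,k}$ whose zero at $0$ has multiplicity exactly $n+1$ (in the second case, with $P(1)\neq0$). -/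

import Mathlib

noncomputable section

/-- The uniform norm `‖f‖_A = sup_{x ∈ A} |f x|` of a real function on a set `A`. -/
def supNormOn (A : Set ℝ) (f : ℝ → ℝ) : ℝ :=
  sSup ((fun x => |f x|) '' A)

/-- The total variation `V_a^b(f) = ∫_a^b |f'(x)| dx` of a continuously differentiable function. -/
def totalVar (a b : ℝ) (f : ℝ → ℝ) : ℝ :=
  ∫ x in a..b, |deriv f x|

/-- The real polynomials `P(x) = x^(n+1) R(x)` with `R` of degree at most `k - 1`. -/
def incompletePoly (n k : ℕ) : Set (Polynomial ℝ) :=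
  {P | ∃ R : Polynomial ℝ, R.degree < k ∧ P = Polynomial.X ^ (n + 1) * R}

/-- The real polynomials of degree at most `n + k` whose zero at `0` has multiplicity
exactly `n + 1`. -/
def incompletePolyExact (n k : ℕ) : Set (Polynomial ℝ) :=
  {P | P.natDegree ≤ n + k ∧ P.rootMultiplicity 0 = n + 1}

/-- The weighted norm `‖P'(x) √(1 - x²)‖_[0,1]`. -/
def bernsteinNorm (P : Polynomial ℝ) : ℝ :=
  supNormOn (Set.Icc 0 1) (fun x => deriv (fun t => P.eval t) x * √(1 - x ^ 2))

/-- The quotients `‖P'(x) √(1 - x²)‖_[0,1] / V_0^1(P)`, for nonzero `P ∈ C`. -/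
def variationQuotients (C : Set (Polynomial ℝ)) : Set ℝ :=
  (fun P => bernsteinNorm P / totalVar 0 1 (fun t => P.eval t)) '' {P | P ∈ C ∧ P ≠ 0}

/-- The quotients `‖P'(x) √(1 - x²)‖_[0,1] / |P(1)|`, for `P ∈ C` with `P(1) ≠ 0`. -/
def endpointQuotients (C : Set (Polynomial ℝ)) : Set ℝ :=
  (fun P => bernsteinNorm P / |P.eval 1|) '' {P | P ∈ C ∧ P.eval 1 ≠ 0}

end

/-! Lower bound: write P' = x^n S with deg S < k, let M be the weighted norm, y = 1 - x and a = k/n.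
Since √(1 - x²) ≥ √y, |P'(1 - y)| ≤ M/√y, whose integral over [0, 4a] is 4M√a. Beyond 4a, Chebyshev
growth lets S increase only like (4y/a)^(k-1), while x^n decays exponentially
(`abs_incomplete_le_exp`), so the tail is at most M√a. Hence the variation is at most 5M√a
(`totalVar_mul_sqrt_le`). If n < 4k, integrating M/√y over [0, 1] suffices. Upper bound: take P' =
q, the probability that the n-th success comes after fewer than k failures, for success probability
x. Then q ≤ 1, (1 - x)q ≤ k/n and ∫ q = k/(n + k), which gives the ratio
(`exists_bernsteinNorm_le`). The middle inequality is |P(1)| ≤ V(P), as P(0) = 0. Minima exist by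
compactness in the k coefficients; perturbing the lowest coefficient of a minimizer handles exact
multiplicity. -/

open Polynomial Set Filter Topology Pointwise

/-! ### Minimizing homogeneous quotients -/

/-- On a finite-dimensional space, a quotient of two continuous absolutely homogeneous functions
whose numerator vanishes only at `0` attains its minimum. -/
lemma exists_forall_div_le_div {E : Type*} [NormedAddCommGroup E] [NormedSpace ℝ E]
    [FiniteDimensional ℝ E] {p q : E → ℝ} (hp : Continuous p) (hq : Continuous q)
    (hps : ∀ (t : ℝ) v, p (t • v) = |t| * p v) (hqs : ∀ (t : ℝ) v, q (t • v) = |t| * q v)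
    (hp0 : ∀ v, v ≠ 0 → 0 < p v) (hq0 : ∀ v, 0 ≤ q v) (hex : ∃ v, q v ≠ 0) :
    ∃ v, q v ≠ 0 ∧ ∀ w, q w ≠ 0 → p v / q v ≤ p w / q w := by
  have q_zero : q 0 = 0 := by simpa using hqs 0 0
  have ne_zero : ∀ w, q w ≠ 0 → w ≠ 0 := by
    rintro w hw rfl
    exact hw q_zero
  have normalize : ∀ w, w ≠ 0 → q (‖w‖⁻¹ • w) / p (‖w‖⁻¹ • w) = q w / p w := by
    intro w hw
    rw [hps, hqs]
    have : |‖w‖⁻¹| ≠ 0 := by simpa using hw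
    exact mul_div_mul_left _ _ this
  have sphere_mem : ∀ w : E, w ≠ 0 → ‖w‖⁻¹ • w ∈ Metric.sphere (0 : E) 1 := by
    intro w hw
    simp [norm_smul, hw]
  obtain ⟨v₀, hv₀⟩ := hex
  -- The inverted quotient is maximized: `p` is nonzero on the whole sphere, whereas `q` may vanish
  -- there.
  have hcont : ContinuousOn (fun v => q v / p v) (Metric.sphere (0 : E) 1) := by
    refine hq.continuousOn.div hp.continuousOn fun v hv => (hp0 v ?_).ne'
    rintro rfl
    simp at hv
  obtain ⟨v, hv, hmax⟩ := (isCompact_sphere (0 : E) 1).exists_isMaxOn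
    ⟨_, sphere_mem v₀ (ne_zero v₀ hv₀)⟩ hcont
  have hv0 : v ≠ 0 := by
    rintro rfl
    simp at hv
  have key : ∀ w, w ≠ 0 → q w / p w ≤ q v / p v := by
    intro w hw
    rw [← normalize w hw]
    exact hmax (sphere_mem w hw)
  have hpos : ∀ w, q w ≠ 0 → 0 < q w := fun w hw => (hq0 w).lt_of_ne' hw
  have hv1 : 0 < q v / p v :=
    (div_pos (hpos v₀ hv₀) (hp0 v₀ (ne_zero v₀ hv₀))).trans_le (key v₀ (ne_zero v₀ hv₀))
  refine ⟨v, fun h => by simp [h] at hv1, fun w hw => ?_⟩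
  have h1 := key w (ne_zero w hw)
  have h2 := one_div_le_one_div_of_le (div_pos (hpos w hw) (hp0 w (ne_zero w hw))) h1
  simpa using h2

/-- The minimum of a quotient of continuous functions is approached off a coordinate hyperplane. -/
lemma isGLB_quotients_coord_ne_zero {ι : Type*} {p q : (ι → ℝ) → ℝ}
    (hp : Continuous p) (hq : Continuous q) (i : ι) {m : ℝ}
    (hm : IsLeast ((fun c => p c / q c) '' {c | q c ≠ 0}) m) :
    IsGLB ((fun c => p c / q c) '' {c | c i ≠ 0 ∧ q c ≠ 0}) m := by
  classical
  obtain ⟨⟨v, hv, rfl⟩, hmin⟩ := hm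
  refine ⟨fun x hx => hmin (image_mono (fun c hc => hc.2) hx), fun b hb => ?_⟩
  let w : ℝ → ι → ℝ := fun t => v + t • Pi.single i 1
  have hw : Continuous w := by fun_prop
  have hw0 : w 0 = v := by simp [w]
  have hlim : Tendsto (fun t => p (w t) / q (w t)) (𝓝[≠] 0) (𝓝 (p v / q v)) := by
    have : ContinuousAt (fun t => p (w t) / q (w t)) 0 :=
      (hp.comp hw).continuousAt.div (hq.comp hw).continuousAt (by simpa [hw0] using hv)
    have h := this.tendsto.mono_left (nhdsWithin_le_nhds (s := {0}ᶜ))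
    rwa [hw0] at h
  have hqw : ∀ᶠ t in 𝓝[≠] (0 : ℝ), q (w t) ≠ 0 :=
    ((hq.comp hw).continuousAt.eventually_ne (by simpa [hw0] using hv)).filter_mono
      nhdsWithin_le_nhds
  have hcoord : ∀ t, w t i = v i + t := by simp [w]
  have hiw : ∀ᶠ t in 𝓝[≠] (0 : ℝ), w t i ≠ 0 := by
    by_cases hvi : v i = 0
    · filter_upwards [self_mem_nhdsWithin] with t ht
      simpa [hcoord, hvi] using ht
    · have : ContinuousAt (fun t => w t i) 0 := by fun_prop
      exact (this.eventually_ne (by simpa [hw0] using hvi)).filter_mono nhdsWithin_le_nhds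
  refine ge_of_tendsto hlim ?_
  filter_upwards [hqw, hiw] with t h1 h2
  exact hb ⟨w t, ⟨h2, h1⟩, rfl⟩

/-! ### Coordinates on incomplete polynomials -/

/-- The polynomial `x^(n+1) * ∑ i, c i * x^i`. -/
noncomputable def incompleteOfCoeff (n k : ℕ) (c : Fin k → ℝ) : ℝ[X] :=
  X ^ (n + 1) * ∑ i, C (c i) * X ^ (i : ℕ)

lemma coeff_sum_fin (k : ℕ) (c : Fin k → ℝ) (j : Fin k) :
    (∑ i, C (c i) * X ^ (i : ℕ) : ℝ[X]).coeff j = c j := by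
  simp [coeff_C_mul, coeff_X_pow, Fin.val_inj]

lemma exists_eq_sum_fin {k : ℕ} {R : ℝ[X]} (hR : R.degree < k) :
    ∃ c : Fin k → ℝ, R = ∑ i, C (c i) * X ^ (i : ℕ) := by
  refine ⟨fun i => R.coeff i, ?_⟩
  ext j
  by_cases hj : j < k
  · exact (coeff_sum_fin k (fun i => R.coeff i) ⟨j, hj⟩).symm
  · rw [coeff_eq_zero_of_degree_lt (hR.trans_le (by exact_mod_cast not_lt.mp hj)),
      coeff_eq_zero_of_degree_lt
        ((degree_sum_fin_lt _).trans_le (by exact_mod_cast not_lt.mp hj))]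

lemma incompletePoly_eq_range (n k : ℕ) :
    incompletePoly n k = range (incompleteOfCoeff n k) := by
  ext P
  constructor
  · rintro ⟨R, hR, rfl⟩
    obtain ⟨c, rfl⟩ := exists_eq_sum_fin hR
    exact ⟨c, rfl⟩
  · rintro ⟨c, rfl⟩
    exact ⟨_, degree_sum_fin_lt c, rfl⟩

lemma incompletePolyExact_eq_image {n k : ℕ} (hk : 1 ≤ k) :
    incompletePolyExact n k = incompleteOfCoeff n k '' {c | c ⟨0, hk⟩ ≠ 0} := by
  ext P
  constructor
  · rintro ⟨hdeg, hmul⟩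
    have hP : P ≠ 0 := by
      rintro rfl
      simp at hmul
    obtain ⟨R, hPR, hR⟩ := exists_eq_pow_rootMultiplicity_mul_and_not_dvd P hP 0
    rw [hmul] at hPR
    simp only [C_0, sub_zero] at hPR hR
    have hR0 : R ≠ 0 := by
      rintro rfl
      simp at hR
    have hRdeg : R.degree < k := by
      rw [hPR, natDegree_mul (by simp) hR0, natDegree_X_pow] at hdeg
      rw [degree_eq_natDegree hR0]
      exact_mod_cast (by omega : R.natDegree < k)
    obtain ⟨c, rfl⟩ := exists_eq_sum_fin hRdeg
    refine ⟨c, ?_, hPR.symm⟩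
    rw [X_dvd_iff] at hR
    change c ⟨0, hk⟩ ≠ 0
    rwa [← coeff_sum_fin k c ⟨0, hk⟩]
  · rintro ⟨c, hc, rfl⟩
    have h0 : (∑ i, C (c i) * X ^ (i : ℕ) : ℝ[X]).coeff 0 ≠ 0 := by
      change c ⟨0, hk⟩ ≠ 0 at hc
      rwa [← coeff_sum_fin k c ⟨0, hk⟩] at hc
    set R : ℝ[X] := ∑ i, C (c i) * X ^ (i : ℕ) with hRdef
    have hR0 : R ≠ 0 := by
      rintro h
      simp [h] at h0
    have hRdeg : R.natDegree < k := (natDegree_lt_iff_degree_lt hR0).2 (degree_sum_fin_lt c)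
    change X ^ (n + 1) * R ∈ incompletePolyExact n k
    refine ⟨?_, ?_⟩
    · rw [natDegree_mul (by simp) hR0, natDegree_X_pow]
      omega
    · have hprod : (X ^ (n + 1) * R : ℝ[X]) ≠ 0 := mul_ne_zero (by simp) hR0
      rw [rootMultiplicity_mul hprod, rootMultiplicity_eq_zero (p := R)]
      · simpa using rootMultiplicity_X_sub_C_pow (0 : ℝ) (n + 1)
      · simpa [IsRoot.def, coeff_zero_eq_eval_zero] using h0

lemma incompleteOfCoeff_smul (n k : ℕ) (t : ℝ) (c : Fin k → ℝ) :
    incompleteOfCoeff n k (t • c) = C t * incompleteOfCoeff n k c := by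
  simp only [incompleteOfCoeff, Pi.smul_apply, smul_eq_mul, C_mul, Finset.mul_sum]
  exact Finset.sum_congr rfl fun i _ => by ring

lemma incompleteOfCoeff_ne_zero {n k : ℕ} {c : Fin k → ℝ} (hc : c ≠ 0) :
    incompleteOfCoeff n k c ≠ 0 := by
  refine mul_ne_zero (by simp) fun h => hc ?_
  ext j
  rw [← coeff_sum_fin k c j, h]
  simp

lemma continuous_eval_incompleteOfCoeff (n k : ℕ) :
    Continuous fun z : (Fin k → ℝ) × ℝ => (incompleteOfCoeff n k z.1).eval z.2 := by
  simp only [incompleteOfCoeff, eval_mul, eval_pow, eval_X, eval_finsetSum, eval_C]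
  fun_prop

lemma continuous_eval_derivative_incompleteOfCoeff (n k : ℕ) :
    Continuous fun z : (Fin k → ℝ) × ℝ => (derivative (incompleteOfCoeff n k z.1)).eval z.2 := by
  simp only [incompleteOfCoeff, derivative_mul, derivative_X_pow, derivative_sum, derivative_C,
    eval_add, eval_mul, eval_pow, eval_X, eval_finsetSum, eval_C, zero_mul, zero_add]
  fun_prop

/-! ### The weighted norm and the variation -/

lemma bernsteinNorm_eq (P : ℝ[X]) :
    bernsteinNorm P = sSup ((fun x => |(derivative P).eval x * √(1 - x ^ 2)|) '' Icc 0 1) := by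
  simp only [bernsteinNorm, supNormOn, Polynomial.deriv]

lemma totalVar_eq (P : ℝ[X]) :
    totalVar 0 1 (fun t => P.eval t) = ∫ x in (0 : ℝ)..1, |(derivative P).eval x| := by
  simp only [totalVar, Polynomial.deriv]

lemma continuous_bernsteinNorm_incompleteOfCoeff (n k : ℕ) :
    Continuous fun c => bernsteinNorm (incompleteOfCoeff n k c) := by
  simp only [bernsteinNorm_eq]
  refine isCompact_Icc.continuous_sSup
    (f := fun c x => |(derivative (incompleteOfCoeff n k c)).eval x * √(1 - x ^ 2)|) ?_
  have h := continuous_eval_derivative_incompleteOfCoeff n k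
  exact (h.mul (by fun_prop : Continuous fun z : (Fin k → ℝ) × ℝ => √(1 - z.2 ^ 2))).abs

lemma continuous_totalVar_incompleteOfCoeff (n k : ℕ) :
    Continuous fun c => totalVar 0 1 (fun t => (incompleteOfCoeff n k c).eval t) := by
  simp only [totalVar_eq]
  exact intervalIntegral.continuous_parametric_intervalIntegral_of_continuous'
    (continuous_eval_derivative_incompleteOfCoeff n k).abs 0 1

lemma abs_derivative_mul_sqrt_le_bernsteinNorm (P : ℝ[X]) {x : ℝ} (hx : x ∈ Icc (0 : ℝ) 1) :
    |(derivative P).eval x| * √(1 - x ^ 2) ≤ bernsteinNorm P := by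
  rw [bernsteinNorm_eq]
  have hbdd : BddAbove ((fun x => |(derivative P).eval x * √(1 - x ^ 2)|) '' Icc 0 1) :=
    (isCompact_Icc.image (by fun_prop)).bddAbove
  refine le_csSup hbdd ⟨x, hx, ?_⟩
  simp [abs_mul]

lemma bernsteinNorm_nonneg (P : ℝ[X]) : 0 ≤ bernsteinNorm P := by
  refine le_trans ?_ (abs_derivative_mul_sqrt_le_bernsteinNorm P (x := 0) (by simp))
  positivity

lemma bernsteinNorm_le {P : ℝ[X]} {B : ℝ}
    (h : ∀ x ∈ Icc (0 : ℝ) 1, |(derivative P).eval x| * √(1 - x ^ 2) ≤ B) :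
    bernsteinNorm P ≤ B := by
  rw [bernsteinNorm_eq]
  refine csSup_le ((nonempty_Icc.2 zero_le_one).image _) ?_
  rintro _ ⟨x, hx, rfl⟩
  simpa [abs_mul, abs_of_nonneg (Real.sqrt_nonneg _)] using h x hx

lemma bernsteinNorm_C_mul (t : ℝ) (P : ℝ[X]) :
    bernsteinNorm (C t * P) = |t| * bernsteinNorm P := by
  rw [bernsteinNorm_eq, bernsteinNorm_eq]
  have : ((fun x => |(derivative (C t * P)).eval x * √(1 - x ^ 2)|) '' Icc 0 1) =
      |t| • ((fun x => |(derivative P).eval x * √(1 - x ^ 2)|) '' Icc 0 1) := by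
    rw [← image_smul, image_image]
    simp [abs_mul, mul_assoc]
  rw [this, Real.sSup_smul_of_nonneg (abs_nonneg t), smul_eq_mul]

lemma totalVar_C_mul (t : ℝ) (P : ℝ[X]) :
    totalVar 0 1 (fun x => (C t * P).eval x) = |t| * totalVar 0 1 (fun x => P.eval x) := by
  rw [totalVar_eq, totalVar_eq, ← intervalIntegral.integral_const_mul]
  simp [abs_mul]

lemma totalVar_nonneg (P : ℝ[X]) : 0 ≤ totalVar 0 1 (fun x => P.eval x) := by
  rw [totalVar_eq]
  exact intervalIntegral.integral_nonneg zero_le_one fun _ _ => abs_nonneg _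

lemma abs_eval_one_le_totalVar {P : ℝ[X]} (h0 : P.eval 0 = 0) :
    |P.eval 1| ≤ totalVar 0 1 (fun x => P.eval x) := by
  have h : ∫ x in (0 : ℝ)..1, (derivative P).eval x = P.eval 1 := by
    rw [intervalIntegral.integral_eq_sub_of_hasDerivAt (fun x _ => P.hasDerivAt x)
      ((derivative P).continuous.intervalIntegrable _ _), h0, sub_zero]
  rw [totalVar_eq, ← h]
  exact intervalIntegral.abs_integral_le_integral_abs zero_le_one

lemma eval_zero_incompleteOfCoeff (n k : ℕ) (c : Fin k → ℝ) :
    (incompleteOfCoeff n k c).eval 0 = 0 := by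
  simp [incompleteOfCoeff]

lemma derivative_ne_zero_of_eval_zero {P : ℝ[X]} (h0 : P.eval 0 = 0) (hP : P ≠ 0) :
    derivative P ≠ 0 := by
  intro h
  rw [eq_C_of_derivative_eq_zero h] at h0 hP
  simp at h0
  simp [h0] at hP

lemma exists_eval_ne_zero {Q : ℝ[X]} (hQ : Q ≠ 0) : ∃ x ∈ Ioo (0 : ℝ) 1, Q.eval x ≠ 0 := by
  by_contra! h
  exact hQ (eq_zero_of_infinite_isRoot Q ((Ioo_infinite zero_lt_one).mono h))

lemma bernsteinNorm_pos {P : ℝ[X]} (h0 : P.eval 0 = 0) (hP : P ≠ 0) : 0 < bernsteinNorm P := by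
  obtain ⟨x, hx, hne⟩ := exists_eval_ne_zero (derivative_ne_zero_of_eval_zero h0 hP)
  refine lt_of_lt_of_le ?_
    (abs_derivative_mul_sqrt_le_bernsteinNorm P (Ioo_subset_Icc_self hx))
  have : 0 < 1 - x ^ 2 := by nlinarith [hx.1, hx.2]
  positivity

lemma totalVar_pos {P : ℝ[X]} (h0 : P.eval 0 = 0) (hP : P ≠ 0) :
    0 < totalVar 0 1 (fun x => P.eval x) := by
  obtain ⟨x, hx, hne⟩ := exists_eval_ne_zero (derivative_ne_zero_of_eval_zero h0 hP)
  rw [totalVar_eq]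
  exact intervalIntegral.integral_pos zero_lt_one (by fun_prop) (fun _ _ => abs_nonneg _)
    ⟨x, Ioo_subset_Icc_self hx, abs_pos.2 hne⟩

/-! ### Existence of both minima -/

/-- Because P(0) = 0, P vanishes exactly when its variation does; the side condition thus becomes a
nonzero denominator. -/
lemma variationQuotients_image (n k : ℕ) (s : Set (Fin k → ℝ)) :
    variationQuotients (incompleteOfCoeff n k '' s) =
      (fun c => bernsteinNorm (incompleteOfCoeff n k c) /
        totalVar 0 1 (fun t => (incompleteOfCoeff n k c).eval t)) ''
        {c | c ∈ s ∧ totalVar 0 1 (fun t => (incompleteOfCoeff n k c).eval t) ≠ 0} := by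
  have hne : ∀ c, incompleteOfCoeff n k c ≠ 0 ↔
      totalVar 0 1 (fun t => (incompleteOfCoeff n k c).eval t) ≠ 0 := fun c =>
    ⟨fun h => (totalVar_pos (eval_zero_incompleteOfCoeff n k c) h).ne',
      fun h h' => h (by simp [h', totalVar])⟩
  ext x
  constructor
  · rintro ⟨_, ⟨⟨c, hc, rfl⟩, hP⟩, rfl⟩
    exact ⟨c, ⟨hc, (hne c).1 hP⟩, rfl⟩
  · rintro ⟨c, ⟨hc, hP⟩, rfl⟩
    exact ⟨_, ⟨⟨c, hc, rfl⟩, (hne c).2 hP⟩, rfl⟩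

lemma endpointQuotients_image (n k : ℕ) (s : Set (Fin k → ℝ)) :
    endpointQuotients (incompleteOfCoeff n k '' s) =
      (fun c => bernsteinNorm (incompleteOfCoeff n k c) / |(incompleteOfCoeff n k c).eval 1|) ''
        {c | c ∈ s ∧ |(incompleteOfCoeff n k c).eval 1| ≠ 0} := by
  ext x
  constructor
  · rintro ⟨_, ⟨⟨c, hc, rfl⟩, hP⟩, rfl⟩
    exact ⟨c, ⟨hc, abs_ne_zero.2 hP⟩, rfl⟩
  · rintro ⟨c, ⟨hc, hP⟩, rfl⟩
    exact ⟨_, ⟨⟨c, hc, rfl⟩, abs_ne_zero.1 hP⟩, rfl⟩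

lemma exists_isLeast_isGLB_bernsteinNorm_div {n k : ℕ} (hk : 1 ≤ k) {q : (Fin k → ℝ) → ℝ}
    (hq : Continuous q) (hqs : ∀ (t : ℝ) v, q (t • v) = |t| * q v)
    (hq0 : ∀ v, 0 ≤ q v) (hex : ∃ v, q v ≠ 0) :
    ∃ m, IsLeast ((fun c => bernsteinNorm (incompleteOfCoeff n k c) / q c) '' {c | q c ≠ 0}) m ∧
      IsGLB ((fun c => bernsteinNorm (incompleteOfCoeff n k c) / q c) ''
        {c | c ⟨0, hk⟩ ≠ 0 ∧ q c ≠ 0}) m := by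
  have hp := continuous_bernsteinNorm_incompleteOfCoeff n k
  obtain ⟨v, hv, hmin⟩ := exists_forall_div_le_div hp hq
    (fun t v => by rw [incompleteOfCoeff_smul, bernsteinNorm_C_mul]) hqs
    (fun v hv => bernsteinNorm_pos (eval_zero_incompleteOfCoeff n k v)
      (incompleteOfCoeff_ne_zero hv)) hq0 hex
  have hleast : IsLeast ((fun c => bernsteinNorm (incompleteOfCoeff n k c) / q c) ''
      {c | q c ≠ 0}) (bernsteinNorm (incompleteOfCoeff n k v) / q v) := by
    refine ⟨⟨v, hv, rfl⟩, ?_⟩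
    rintro _ ⟨w, hw, rfl⟩
    exact hmin w hw
  exact ⟨_, hleast, isGLB_quotients_coord_ne_zero hp hq _ hleast⟩

lemma exists_eval_one_incompleteOfCoeff_ne_zero (n : ℕ) {k : ℕ} (hk : 1 ≤ k) :
    ∃ c, (incompleteOfCoeff n k c).eval 1 ≠ 0 :=
  ⟨Pi.single ⟨0, hk⟩ 1, by simp [incompleteOfCoeff, eval_finsetSum]⟩

lemma exists_min_variationQuotients (n : ℕ) {k : ℕ} (hk : 1 ≤ k) :
    ∃ m, IsLeast (variationQuotients (incompletePoly n k)) m ∧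
      IsGLB (variationQuotients (incompletePolyExact n k)) m := by
  rw [incompletePoly_eq_range, incompletePolyExact_eq_image hk, ← image_univ,
    variationQuotients_image, variationQuotients_image]
  simp only [mem_univ, true_and, mem_ofPred_eq]
  refine exists_isLeast_isGLB_bernsteinNorm_div hk (continuous_totalVar_incompleteOfCoeff n k)
    (fun t v => by rw [incompleteOfCoeff_smul, totalVar_C_mul]) (fun v => totalVar_nonneg _) ?_
  obtain ⟨c, hc⟩ := exists_eval_one_incompleteOfCoeff_ne_zero n hk
  exact ⟨c, ((abs_pos.2 hc).trans_le
    (abs_eval_one_le_totalVar (eval_zero_incompleteOfCoeff n k c))).ne'⟩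

lemma exists_min_endpointQuotients (n : ℕ) {k : ℕ} (hk : 1 ≤ k) :
    ∃ m, IsLeast (endpointQuotients (incompletePoly n k)) m ∧
      IsGLB (endpointQuotients (incompletePolyExact n k)) m := by
  rw [incompletePoly_eq_range, incompletePolyExact_eq_image hk, ← image_univ,
    endpointQuotients_image, endpointQuotients_image]
  simp only [mem_univ, true_and, mem_ofPred_eq]
  refine exists_isLeast_isGLB_bernsteinNorm_div hk ?_
    (fun t v => by rw [incompleteOfCoeff_smul]; simp [abs_mul]) (fun v => abs_nonneg _) ?_
  · exact ((continuous_eval_incompleteOfCoeff n k).comp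
      (by fun_prop : Continuous fun c : Fin k → ℝ => (c, (1 : ℝ)))).abs
  · obtain ⟨c, hc⟩ := exists_eval_one_incompleteOfCoeff_ne_zero n hk
    exact ⟨c, abs_ne_zero.2 hc⟩

/-! ### Growth of S and decay of x^n S -/

lemma eval_T_real_le_two_mul_pow (N : ℕ) {s : ℝ} (hs : 1 ≤ s) :
    (Chebyshev.T ℝ N).eval s ≤ (2 * s) ^ N := by
  induction N with
  | zero => simp
  | succ N ih =>
    rcases N with _ | N
    · simp; linarith
    · have h := Chebyshev.T_add_two ℝ (N : ℤ)
      have h1 := Chebyshev.one_le_eval_T_real (N : ℤ) hs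
      have h2 : (Chebyshev.T ℝ ((N + 1 + 1 : ℕ) : ℤ)).eval s =
          2 * s * (Chebyshev.T ℝ ((N + 1 : ℕ) : ℤ)).eval s - (Chebyshev.T ℝ (N : ℤ)).eval s := by
        push_cast
        rw [show (N : ℤ) + 1 + 1 = N + 2 by ring, h]
        simp
      rw [h2, pow_succ (2 * s) (N + 1)]
      nlinarith

/-- Growth of a polynomial outside `[-1, 1]`, from the extremality of Chebyshev polynomials. -/
lemma abs_eval_le_mul_two_mul_pow {N : ℕ} {p : ℝ[X]} (hp : p.degree ≤ N) {D : ℝ} (hD : 0 < D)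
    (hbd : ∀ x ∈ Icc (-1 : ℝ) 1, |p.eval x| ≤ D) {s : ℝ} (hs : 1 ≤ s) :
    |p.eval s| ≤ D * (2 * s) ^ N := by
  have key : ∀ q : ℝ[X], q.degree ≤ N → (∀ x ∈ Icc (-1 : ℝ) 1, |q.eval x| ≤ D) →
      q.eval s ≤ D * (2 * s) ^ N := by
    intro q hq hqb
    -- `k := 0` selects the polynomial itself rather than a derivative.
    have h := Chebyshev.eval_iterate_derivative_le_of_forall_abs_le_one (n := N) (k := 0)
      (P := C D⁻¹ * q) hs ((degree_C_mul_of_isUnit (isUnit_iff_ne_zero.2 (inv_ne_zero hD.ne')) q).trans_le hq) (fun x hx => ?_)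
    · simp only [Function.iterate_zero, id, eval_mul, eval_C] at h
      have h3 := h.trans (eval_T_real_le_two_mul_pow N hs)
      rwa [inv_mul_le_iff₀ hD] at h3
    · rw [eval_mul, eval_C, abs_mul, abs_of_pos (inv_pos.2 hD), inv_mul_le_iff₀ hD, mul_one]
      exact hqb x hx
  refine abs_le'.2 ⟨key p hp hbd, ?_⟩
  simpa using key (-p) (by simpa using hp) (by simpa using hbd)

/-- Substituting y = a s² turns the weight √y into √a |s|, so s S(1 - a s²) is a polynomial of
degree at most 2k - 1 bounded by B/√a on [-1, 1]. The growth bound applies at s = √(y/a). -/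
lemma abs_eval_one_sub_le {k : ℕ} (hk : 1 ≤ k) {S : ℝ[X]} (hS : S.degree < k) {a B : ℝ}
    (ha : 0 < a) (hB : 0 < B)
    (hbd : ∀ y ∈ Icc (0 : ℝ) a, |S.eval (1 - y)| * √y ≤ B) {y : ℝ} (hy : a ≤ y) :
    |S.eval (1 - y)| ≤ B / √a * 2 * (4 * y / a) ^ (k - 1) := by
  have hsa : 0 < √a := Real.sqrt_pos.2 ha
  set p : ℝ[X] := X * S.comp (1 - C a * X ^ 2) with hpdef
  have hpe : ∀ s, p.eval s = s * S.eval (1 - a * s ^ 2) := by simp [hpdef]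
  have hSn : S.natDegree ≤ k - 1 := by
    by_cases h0 : S = 0
    · simp [h0]
    · have := (natDegree_lt_iff_degree_lt h0).2 hS
      omega
  have hinner : (1 - C a * X ^ 2 : ℝ[X]).natDegree ≤ 2 := by compute_degree
  have hpd : p.degree ≤ ((2 * (k - 1) + 1 : ℕ) : WithBot ℕ) := by
    refine degree_le_of_natDegree_le ?_
    refine natDegree_mul_le.trans ?_
    rw [natDegree_comp, natDegree_X]
    nlinarith [Nat.mul_le_mul hSn hinner]
  have hpb : ∀ s ∈ Icc (-1 : ℝ) 1, |p.eval s| ≤ B / √a := by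
    intro s hs
    have hs2 : s ^ 2 ≤ 1 := by nlinarith [hs.1, hs.2]
    have h := hbd (a * s ^ 2) ⟨by positivity, by nlinarith⟩
    rw [Real.sqrt_mul ha.le, Real.sqrt_sq_eq_abs] at h
    rw [hpe, abs_mul, le_div_iff₀ hsa]
    linarith
  set s := √(y / a) with hs
  have hya : 1 ≤ y / a := (one_le_div ha).2 hy
  have hs1 : 1 ≤ s := Real.one_le_sqrt.2 hya
  have hs2 : s ^ 2 = y / a := Real.sq_sqrt (by linarith)
  have h := abs_eval_le_mul_two_mul_pow hpd (div_pos hB hsa) hpb hs1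
  rw [hpe, abs_mul, abs_of_pos (by linarith : 0 < s), pow_succ (2 * s), pow_mul, mul_pow, hs2,
    mul_div_cancel₀ y ha.ne'] at h
  have h4 : (2 ^ 2 * (y / a)) = 4 * y / a := by ring
  rw [h4] at h
  have : s * |S.eval (1 - y)| ≤ s * (B / √a * 2 * (4 * y / a) ^ (k - 1)) := by
    calc _ ≤ _ := h
      _ = _ := by ring
  exact le_of_mul_le_mul_left this (by linarith)

/-- An incomplete polynomial `x^n S(x)` decays exponentially away from `1`. -/
lemma abs_incomplete_le_exp {n k : ℕ} (hk : 1 ≤ k) (hn : 4 * k ≤ n) {S : ℝ[X]}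
    (hS : S.degree < k) {M : ℝ} (hM : 0 < M)
    (hbd : ∀ y ∈ Icc (0 : ℝ) 1, |(X ^ n * S).eval (1 - y)| * √y ≤ M) {y : ℝ}
    (hy : 4 * ((k : ℝ) / n) ≤ y) (hy1 : y ≤ 1) :
    |(X ^ n * S).eval (1 - y)| ≤
      M / √((k : ℝ) / n) * 2 * 16 ^ (k - 1) * Real.exp (-(3 / 4 * n) * y) := by
  have hk0 : (0 : ℝ) < k := by exact_mod_cast hk
  have hn0 : (0 : ℝ) < n := by exact_mod_cast (by omega : 0 < n)
  have hkn : (4 : ℝ) * k ≤ n := by exact_mod_cast hn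
  set a : ℝ := k / n with hadef
  have ha : 0 < a := by positivity
  have ha4 : a ≤ 1 / 4 := by
    rw [hadef, div_le_iff₀ hn0]; linarith
  have hna : n * a = k := by rw [hadef]; field_simp
  have hB : 0 < M / (1 - a) ^ n := div_pos hM (pow_pos (by linarith) n)
  have h1 := abs_eval_one_sub_le hk hS ha hB (fun z hz => ?_) (by linarith : a ≤ y)
  swap
  · have h := hbd z ⟨hz.1, by linarith [hz.2]⟩
    rw [eval_mul, eval_pow, eval_X, abs_mul, abs_pow, abs_of_nonneg (by linarith [hz.2] : 0 ≤ 1 - z)]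
      at h
    rw [le_div_iff₀ (pow_pos (by linarith) n)]
    calc |S.eval (1 - z)| * √z * (1 - a) ^ n ≤ |S.eval (1 - z)| * √z * (1 - z) ^ n := by
          gcongr
          · linarith
          · exact hz.2
      _ = (1 - z) ^ n * |S.eval (1 - z)| * √z := by ring
      _ ≤ M := h
  have hexp : (1 - y) ^ n ≤ (1 - a) ^ n * Real.exp (-(n * (y - a))) := by
    have h2 : 1 - y ≤ (1 - a) * Real.exp (-(y - a)) := by
      have := Real.add_one_le_exp (-(y - a))
      nlinarith
    calc (1 - y) ^ n ≤ ((1 - a) * Real.exp (-(y - a))) ^ n := by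
          gcongr
      _ = _ := by rw [mul_pow, ← Real.exp_nat_mul]; ring_nf
  -- With u = y/(4a) ≥ 1, 4y/a = 16u and u ≤ exp(u - 1). This costs only a quarter of the decay
  -- exp(-ny).
  have hpow : (4 * y / a) ^ (k - 1) ≤ 16 ^ (k - 1) * Real.exp (n * y / 4 - k) := by
    have h3 : y / (4 * a) ≤ Real.exp (y / (4 * a) - 1) := by
      have := Real.add_one_le_exp (y / (4 * a) - 1)
      linarith
    have h5 : 0 ≤ y / (4 * a) - 1 := by
      rw [sub_nonneg, one_le_div (by positivity)]; exact hy
    calc (4 * y / a) ^ (k - 1) = 16 ^ (k - 1) * (y / (4 * a)) ^ (k - 1) := by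
          rw [← mul_pow]; congr 1; field_simp; ring
      _ ≤ 16 ^ (k - 1) * Real.exp (y / (4 * a) - 1) ^ k := by
          gcongr
          calc (y / (4 * a)) ^ (k - 1) ≤ Real.exp (y / (4 * a) - 1) ^ (k - 1) := by
                gcongr
                linarith
            _ ≤ _ := pow_le_pow_right₀ (Real.one_le_exp h5) (by omega)
      _ = _ := by
          rw [← Real.exp_nat_mul]
          congr 2
          rw [hadef]; field_simp
  rw [eval_mul, eval_pow, eval_X, abs_mul, abs_pow, abs_of_nonneg (by linarith : 0 ≤ 1 - y)]
  have h1a : 0 < (1 - a) ^ n := pow_pos (by linarith) n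
  calc (1 - y) ^ n * |S.eval (1 - y)|
      ≤ ((1 - a) ^ n * Real.exp (-(n * (y - a)))) *
        (M / (1 - a) ^ n / √a * 2 * (16 ^ (k - 1) * Real.exp (n * y / 4 - k))) := by
        gcongr
        exact h1.trans (by gcongr)
    _ = M / √a * 2 * 16 ^ (k - 1) * (Real.exp (-(n * (y - a))) * Real.exp (n * y / 4 - k)) := by
        field_simp
    _ = _ := by
        rw [← Real.exp_add]
        congr 2
        linear_combination hna

/-! ### Integral estimates and the lower bound -/

lemma integral_inv_sqrt {b : ℝ} (hb : 0 ≤ b) : ∫ y in (0 : ℝ)..b, (√y)⁻¹ = 2 * √b := by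
  have h : ∫ y in (0 : ℝ)..b, (√y)⁻¹ = ∫ y in (0 : ℝ)..b, y ^ (-(1 / 2) : ℝ) := by
    refine intervalIntegral.integral_congr fun y hy => ?_
    rw [uIcc_of_le hb] at hy
    simp only [Real.sqrt_eq_rpow, Real.rpow_neg hy.1]
  rw [h, integral_rpow (Or.inl (by norm_num)), Real.sqrt_eq_rpow]
  norm_num
  ring

lemma intervalIntegrable_inv_sqrt {b : ℝ} (hb : 0 ≤ b) :
    IntervalIntegrable (fun y : ℝ => (√y)⁻¹) MeasureTheory.volume 0 b := by
  have h : IntervalIntegrable (fun y : ℝ => y ^ (-(1 / 2) : ℝ)) MeasureTheory.volume 0 b :=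
    intervalIntegral.intervalIntegrable_rpow' (by norm_num)
  refine h.congr fun y hy => ?_
  rw [uIoc_of_le hb] at hy
  simp only [Real.sqrt_eq_rpow, Real.rpow_neg hy.1.le]

lemma integral_abs_le_of_mul_sqrt_le {f : ℝ → ℝ} (hf : Continuous f) {M b : ℝ} (hb : 0 ≤ b)
    (h : ∀ y ∈ Icc (0 : ℝ) b, |f y| * √y ≤ M) : ∫ y in (0 : ℝ)..b, |f y| ≤ 2 * M * √b := by
  calc ∫ y in (0 : ℝ)..b, |f y| ≤ ∫ y in (0 : ℝ)..b, M * (√y)⁻¹ := by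
        refine intervalIntegral.integral_mono_on_of_le_Ioo hb (hf.abs.intervalIntegrable _ _)
          ((intervalIntegrable_inv_sqrt hb).const_mul M) fun y hy => ?_
        rw [← div_eq_mul_inv, le_div_iff₀ (Real.sqrt_pos.2 hy.1)]
        exact h y (Ioo_subset_Icc_self hy)
    _ = 2 * M * √b := by
        rw [intervalIntegral.integral_const_mul, integral_inv_sqrt hb]
        ring

/-- The cutoff 4k/n makes the decay factor exp(-3k) at the start of the tail, and e³ > 16 absorbs
the growth constant. -/
lemma sixteen_pow_mul_exp_le {k : ℕ} (hk : 1 ≤ k) :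
    (16 : ℝ) ^ (k - 1) * Real.exp (-(3 * k)) ≤ 1 / 16 := by
  have h16 : (16 : ℝ) * Real.exp (-3) ≤ 1 := by
    have h1 := Real.exp_one_gt_d9
    have h2 : (16 : ℝ) ≤ Real.exp 3 := by
      calc (16 : ℝ) ≤ 2.7 ^ 3 := by norm_num
        _ ≤ Real.exp 1 ^ 3 := by gcongr; linarith
        _ = Real.exp 3 := by rw [← Real.exp_nat_mul]; norm_num
    rw [Real.exp_neg, ← div_eq_mul_inv]
    exact (div_le_one (Real.exp_pos 3)).2 h2
  have h : (16 : ℝ) * (16 ^ (k - 1) * Real.exp (-(3 * k))) ≤ 1 := by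
    rw [← mul_assoc, ← pow_succ', Nat.sub_add_cancel hk,
      show -(3 * (k : ℝ)) = k * (-3) by ring, Real.exp_nat_mul, ← mul_pow]
    exact pow_le_one₀ (by positivity) h16
  linarith

lemma integral_abs_incomplete_tail_le {n k : ℕ} (hk : 1 ≤ k) (hn : 4 * k ≤ n) {S : ℝ[X]}
    (hS : S.degree < k) {M : ℝ} (hM : 0 < M)
    (hbd : ∀ y ∈ Icc (0 : ℝ) 1, |(X ^ n * S).eval (1 - y)| * √y ≤ M) :
    ∫ y in (4 * ((k : ℝ) / n))..1, |(X ^ n * S).eval (1 - y)| ≤ M * √((k : ℝ) / n) := by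
  have hk0 : (1 : ℝ) ≤ k := by exact_mod_cast hk
  have hn0 : (0 : ℝ) < n := by exact_mod_cast (by omega : 0 < n)
  have hkn : (4 : ℝ) * k ≤ n := by exact_mod_cast hn
  set a : ℝ := k / n with hadef
  have ha : 0 < a := by positivity
  have ha4 : 4 * a ≤ 1 := by
    rw [hadef, ← mul_div_assoc, div_le_one hn0]; exact hkn
  have hna : n * a = k := by rw [hadef]; field_simp
  have hsa : 0 < √a := Real.sqrt_pos.2 ha
  have hc : -(3 / 4 * (n : ℝ)) ≠ 0 := by
    have : 0 < 3 / 4 * (n : ℝ) := by positivity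
    linarith
  have hexp : ∫ y in (4 * a)..1, Real.exp (-(3 / 4 * n) * y) ≤
      4 / (3 * n) * Real.exp (-(3 * k)) := by
    rw [intervalIntegral.integral_comp_mul_left (fun y => Real.exp y) hc, integral_exp,
      smul_eq_mul, show -(3 / 4 * (n : ℝ)) * (4 * a) = -(3 * k) by rw [← hna]; ring]
    have h1 : (-(3 / 4 * (n : ℝ)))⁻¹ = -(4 / (3 * n)) := by field_simp
    have h2 : 0 < 4 / (3 * (n : ℝ)) * Real.exp (-(3 / 4 * n) * 1) := by positivity
    rw [h1]
    linarith
  calc ∫ y in (4 * a)..1, |(X ^ n * S).eval (1 - y)|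
      ≤ ∫ y in (4 * a)..1, M / √a * 2 * 16 ^ (k - 1) * Real.exp (-(3 / 4 * n) * y) := by
        refine intervalIntegral.integral_mono_on ha4
          (Continuous.intervalIntegrable (by fun_prop) _ _)
          (Continuous.intervalIntegrable (by fun_prop) _ _) fun y hy => ?_
        exact abs_incomplete_le_exp hk hn hS hM hbd hy.1 hy.2
    _ ≤ M / √a * 2 * 16 ^ (k - 1) * (4 / (3 * n) * Real.exp (-(3 * k))) := by
        rw [intervalIntegral.integral_const_mul]
        gcongr
    _ = M / √a * 2 * (4 / (3 * n)) * (16 ^ (k - 1) * Real.exp (-(3 * k))) := by ring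
    _ ≤ M / √a * 2 * (4 / (3 * n)) * (1 / 16) := by
        gcongr
        exact sixteen_pow_mul_exp_le hk
    _ = M / √a * (1 / n) / 6 := by ring
    _ ≤ M / √a * a := by
        have : 1 / (n : ℝ) ≤ a := by rw [hadef]; gcongr
        have h0 : 0 < M / √a := by positivity
        have h1 : 0 < 1 / (n : ℝ) := by positivity
        nlinarith
    _ = M * √a := by
        rw [div_mul_eq_mul_div, mul_div_assoc, Real.div_sqrt]

lemma exists_derivative_X_pow_mul (n k : ℕ) {R : ℝ[X]} (hR : R.degree < k) :
    ∃ S : ℝ[X], S.degree < k ∧ derivative (X ^ (n + 1) * R) = X ^ n * S := by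
  refine ⟨C ((n : ℝ) + 1) * R + X * derivative R, ?_, ?_⟩
  · have h1 : (C ((n : ℝ) + 1) * R).degree < k := by
      rw [degree_C_mul_of_isUnit (isUnit_iff_ne_zero.2 (by positivity))]
      exact hR
    have h2 : (X * derivative R : ℝ[X]).degree < (k : WithBot ℕ) := by
      by_cases h0 : R = 0
      · simp [h0]
      · refine lt_of_le_of_lt ?_ hR
        rw [degree_eq_natDegree h0]
        by_cases h3 : R.natDegree = 0
        · rw [eq_C_of_natDegree_eq_zero h3]
          simp
        · refine degree_le_of_natDegree_le (natDegree_mul_le.trans ?_)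
          have := natDegree_derivative_lt h3
          rw [natDegree_X]
          omega
    exact (degree_add_le _ _).trans_lt (max_lt h1 h2)
  · simp only [derivative_mul, derivative_X_pow, Nat.cast_add, Nat.cast_one, Nat.add_sub_cancel]
    ring

/-- The lower bound: the total variation of an incomplete polynomial is controlled by its
weighted Bernstein norm. -/
lemma totalVar_mul_sqrt_le {n k : ℕ} (hn : 1 ≤ n) (hk : 1 ≤ k) {P : ℝ[X]}
    (hP : P ∈ incompletePoly n k) (hP0 : P ≠ 0) :
    1 / 6 * √((n : ℝ) / k) * totalVar 0 1 (fun t => P.eval t) ≤ bernsteinNorm P := by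
  obtain ⟨R, hR, rfl⟩ := hP
  obtain ⟨S, hS, hd⟩ := exists_derivative_X_pow_mul n k hR
  have hM : 0 < bernsteinNorm (X ^ (n + 1) * R) := bernsteinNorm_pos (by simp) hP0
  set M := bernsteinNorm (X ^ (n + 1) * R) with hMdef
  have hbd : ∀ y ∈ Icc (0 : ℝ) 1, |(X ^ n * S).eval (1 - y)| * √y ≤ M := by
    intro y hy
    have h := abs_derivative_mul_sqrt_le_bernsteinNorm (X ^ (n + 1) * R) (x := 1 - y)
      ⟨by linarith [hy.2], by linarith [hy.1]⟩
    rw [hd] at h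
    refine le_trans ?_ h
    -- With x = 1 - y, 1 - x² = y(2 - y) ≥ y.
    gcongr
    nlinarith [hy.1, hy.2]
  have hV : totalVar 0 1 (fun t => (X ^ (n + 1) * R : ℝ[X]).eval t) =
      ∫ y in (0 : ℝ)..1, |(X ^ n * S).eval (1 - y)| := by
    rw [totalVar_eq, hd,
      intervalIntegral.integral_comp_sub_left (fun x => |(X ^ n * S : ℝ[X]).eval x|) 1]
    simp
  have hk0 : (1 : ℝ) ≤ k := by exact_mod_cast hk
  have hn0 : (1 : ℝ) ≤ n := by exact_mod_cast hn
  have hcont : Continuous fun y : ℝ => (X ^ n * S).eval (1 - y) := by fun_prop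
  rw [hV]
  rcases lt_or_ge n (4 * k) with h4 | h4
  · have h1 := integral_abs_le_of_mul_sqrt_le hcont zero_le_one hbd
    have h2 : √((n : ℝ) / k) ≤ 2 := by
      rw [Real.sqrt_le_left (by norm_num), div_le_iff₀ (by linarith)]
      have : (n : ℝ) < 4 * k := by exact_mod_cast h4
      linarith
    rw [Real.sqrt_one] at h1
    have h3 := Real.sqrt_nonneg ((n : ℝ) / k)
    nlinarith
  · have h1 := integral_abs_incomplete_tail_le hk h4 hS hM hbd
    set a : ℝ := k / n with hadef
    have ha : 0 < a := by positivity
    have ha4 : 4 * a ≤ 1 := by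
      rw [hadef, ← mul_div_assoc, div_le_one (by linarith)]
      exact_mod_cast h4
    have h2 := integral_abs_le_of_mul_sqrt_le hcont (b := 4 * a) (by positivity)
      (fun y hy => hbd y ⟨hy.1, hy.2.trans ha4⟩)
    rw [Real.sqrt_mul (by norm_num), show √(4 : ℝ) = 2 by
      rw [show (4 : ℝ) = 2 ^ 2 by norm_num]; exact Real.sqrt_sq (by norm_num)] at h2
    rw [← intervalIntegral.integral_add_adjacent_intervals (b := 4 * a)
      (hcont.abs.intervalIntegrable _ _) (hcont.abs.intervalIntegrable _ _)]
    have hinv : √((n : ℝ) / k) * √a = 1 := by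
      rw [← Real.sqrt_mul (by positivity), hadef, div_mul_div_cancel₀ (by positivity),
        div_self (by positivity), Real.sqrt_one]
    -- The pieces contribute 4M√a and M√a, so even 1/5 would suffice in this case.
    calc 1 / 6 * √((n : ℝ) / k) * _ ≤ 1 / 6 * √((n : ℝ) / k) * (2 * M * (2 * √a) + M * √a) := by
          gcongr
      _ = 5 / 6 * M * (√((n : ℝ) / k) * √a) := by ring
      _ ≤ M := by rw [hinv]; linarith

/-! ### The negative binomial example and the upper bound -/

/-- The polynomial `x^(m+1) ∑_{i<k} (m+i choose m) (1-x)^i`: the distribution function of a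
negative binomial law. -/
noncomputable def negBinomialCDF (m k : ℕ) : ℝ[X] :=
  X ^ (m + 1) * ∑ i ∈ Finset.range k, C ((i + m).choose m : ℝ) * (1 - X) ^ i

lemma eval_negBinomialCDF (m k : ℕ) (x : ℝ) :
    (negBinomialCDF m k).eval x =
      x ^ (m + 1) * ∑ i ∈ Finset.range k, ((i + m).choose m : ℝ) * (1 - x) ^ i := by
  simp [negBinomialCDF, eval_finsetSum]

lemma negBinomialCDF_nonneg (m k : ℕ) {x : ℝ} (hx : x ∈ Icc (0 : ℝ) 1) :
    0 ≤ (negBinomialCDF m k).eval x := by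
  rw [eval_negBinomialCDF]
  have h0 := hx.1
  have h1 : 0 ≤ 1 - x := by linarith [hx.2]
  positivity

/-- For x > 0 the full series sums to x^(-(m+1)) and its terms are nonnegative. -/
lemma negBinomialCDF_le_one (m k : ℕ) {x : ℝ} (hx : x ∈ Icc (0 : ℝ) 1) :
    (negBinomialCDF m k).eval x ≤ 1 := by
  rw [eval_negBinomialCDF]
  rcases hx.1.eq_or_lt with rfl | h0
  · simp
  · have h1 : 0 ≤ 1 - x := by linarith [hx.2]
    have hs := hasSum_choose_mul_geometric_of_norm_lt_one (𝕜 := ℝ) m (r := 1 - x)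
      (by rw [Real.norm_of_nonneg h1]; linarith)
    have h2 := sum_le_hasSum (Finset.range k) (fun i _ => by positivity) hs
    rw [sub_sub_cancel, le_div_iff₀ (by positivity)] at h2
    linarith

lemma choose_succ_add_mul (m i : ℕ) :
    ((i + 1 + m).choose m : ℝ) * (i + 1) = (i + m).choose m * (i + m + 1) := by
  have h := Nat.choose_mul_succ_eq (i + m) m
  rw [show i + m + 1 - m = i + 1 by omega, show i + m + 1 = i + 1 + m by ring] at h
  have h' : (((i + m).choose m * (i + 1 + m) : ℕ) : ℝ) =
    (((i + 1 + m).choose m * (i + 1) : ℕ) : ℝ) := by rw [h]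
  push_cast at h'
  linarith

/-- Multiplying by 1 - x shifts each term to the next one times (i + 1)/(i + m + 1) ≤ k/(m + 1); the
shifted terms belong to the sum of length k + 1, which is at most 1. -/
lemma one_sub_mul_negBinomialCDF_le (m k : ℕ) {x : ℝ} (hx : x ∈ Icc (0 : ℝ) 1) :
    (1 - x) * (negBinomialCDF m k).eval x ≤ k / (m + 1) := by
  have h0 := hx.1
  have h1 : 0 ≤ 1 - x := by linarith [hx.2]
  have hterm : ∀ i ∈ Finset.range k, ((i + m).choose m : ℝ) * (1 - x) ^ (i + 1) ≤
      k / (m + 1) * (((i + 1 + m).choose m : ℝ) * (1 - x) ^ (i + 1)) := by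
    intro i hi
    have hik : ((i + 1 : ℕ) : ℝ) ≤ k := by exact_mod_cast Finset.mem_range.1 hi
    have hchoose := choose_succ_add_mul m i
    rw [← mul_assoc]
    gcongr
    rw [div_mul_eq_mul_div, le_div_iff₀ (by positivity)]
    push_cast at hik
    have hc0 : (0 : ℝ) ≤ (i + 1 + m).choose m := by positivity
    have hc1 : (0 : ℝ) ≤ (i + m).choose m := by positivity
    nlinarith [mul_le_mul_of_nonneg_right hik hc0, mul_nonneg hc1 (Nat.cast_nonneg (α := ℝ) i)]
  have hsum := negBinomialCDF_le_one m (k + 1) hx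
  rw [eval_negBinomialCDF, Finset.sum_range_succ'] at hsum
  rw [eval_negBinomialCDF]
  calc (1 - x) * (x ^ (m + 1) * ∑ i ∈ Finset.range k, ((i + m).choose m : ℝ) * (1 - x) ^ i)
      = x ^ (m + 1) * ∑ i ∈ Finset.range k, ((i + m).choose m : ℝ) * (1 - x) ^ (i + 1) := by
        rw [mul_left_comm, Finset.mul_sum]
        congr 1
        exact Finset.sum_congr rfl fun i _ => by ring
    _ ≤ x ^ (m + 1) * ∑ i ∈ Finset.range k,
          (k : ℝ) / (m + 1) * (((i + 1 + m).choose m : ℝ) * (1 - x) ^ (i + 1)) := by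
        exact mul_le_mul_of_nonneg_left (Finset.sum_le_sum hterm) (pow_nonneg h0 _)
    _ = k / (m + 1) * (x ^ (m + 1) * ∑ i ∈ Finset.range k,
          ((i + 1 + m).choose m : ℝ) * (1 - x) ^ (i + 1)) := by
        rw [← Finset.mul_sum]; ring
    _ ≤ k / (m + 1) * 1 := by
        gcongr
        refine le_trans ?_ hsum
        gcongr
        simp
    _ = _ := mul_one _

/-- Integrate the derivative of x^(n+1) (1 - x)^(i+1), which vanishes at both endpoints. -/
lemma integral_pow_mul_one_sub_pow_succ (n i : ℕ) :
    (n + i + 2 : ℝ) * ∫ x in (0 : ℝ)..1, x ^ n * (1 - x) ^ (i + 1) =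
      (i + 1) * ∫ x in (0 : ℝ)..1, x ^ n * (1 - x) ^ i := by
  have hderiv : ∀ x : ℝ, HasDerivAt (fun x : ℝ => x ^ (n + 1) * (1 - x) ^ (i + 1))
      ((n + i + 2) * (x ^ n * (1 - x) ^ (i + 1)) - (i + 1) * (x ^ n * (1 - x) ^ i)) x := by
    intro x
    have h1 := hasDerivAt_pow (n + 1) x
    have h2 := ((hasDerivAt_id x).const_sub 1).pow (i + 1)
    refine (h1.mul h2).congr_deriv ?_
    simp only [Pi.pow_apply, id, Nat.add_sub_cancel, Nat.cast_add, Nat.cast_one]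
    ring
  have hi := intervalIntegral.integral_eq_sub_of_hasDerivAt (a := 0) (b := 1)
    (fun x _ => hderiv x) (Continuous.intervalIntegrable (by fun_prop) _ _)
  rw [intervalIntegral.integral_sub (Continuous.intervalIntegrable (by fun_prop) _ _)
    (Continuous.intervalIntegrable (by fun_prop) _ _), intervalIntegral.integral_const_mul,
    intervalIntegral.integral_const_mul] at hi
  simp at hi
  linarith

lemma choose_mul_integral_pow_mul_one_sub_pow (m i : ℕ) :
    ((i + m).choose m : ℝ) * ∫ x in (0 : ℝ)..1, x ^ (m + 1) * (1 - x) ^ i =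
      (m + 1) / ((m + 1 + i) * (m + 2 + i)) := by
  induction i with
  | zero =>
    simp
    field_simp
    ring
  | succ i ih =>
    have hrec := integral_pow_mul_one_sub_pow_succ (m + 1) i
    have hchoose := choose_succ_add_mul m i
    push_cast at hrec ⊢
    set I := ∫ x in (0 : ℝ)..1, x ^ (m + 1) * (1 - x) ^ i
    set J := ∫ x in (0 : ℝ)..1, x ^ (m + 1) * (1 - x) ^ (i + 1)
    rw [eq_div_iff (by positivity)] at ih ⊢
    have hi : (i + 1 : ℝ) ≠ 0 := by positivity
    apply mul_left_cancel₀ hi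
    linear_combination J * (m + 1 + (i + 1)) * (m + 2 + (i + 1)) * hchoose +
      (i + m).choose m * (i + m + 1) * (m + 1 + (i + 1)) * hrec + (i + 1) * ih

/-- The integrated terms telescope, each being (m + 1)(1/(m + 1 + i) - 1/(m + 2 + i)). -/
lemma integral_negBinomialCDF (m k : ℕ) :
    ∫ x in (0 : ℝ)..1, (negBinomialCDF m k).eval x = k / (m + 1 + k) := by
  simp only [eval_negBinomialCDF, Finset.mul_sum]
  rw [intervalIntegral.integral_finsetSum
    (fun i _ => Continuous.intervalIntegrable (by fun_prop) _ _)]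
  have h : ∀ i : ℕ, ∫ x in (0 : ℝ)..1, x ^ (m + 1) * (((i + m).choose m : ℝ) * (1 - x) ^ i) =
      (m + 1) / ((m + 1 + i) * (m + 2 + i)) := by
    intro i
    rw [← choose_mul_integral_pow_mul_one_sub_pow, ← intervalIntegral.integral_const_mul]
    congr 1
    ext x
    ring
  simp only [h]
  induction k with
  | zero => simp
  | succ k ih =>
    rw [Finset.sum_range_succ, ih]
    push_cast
    field_simp
    ring

lemma exists_derivative_eq_X_pow_mul (n k : ℕ) {S : ℝ[X]} (hS : S.degree < k) :
    ∃ P ∈ incompletePoly n k, derivative P = X ^ n * S := by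
  obtain ⟨c, rfl⟩ := exists_eq_sum_fin hS
  refine ⟨_, ⟨∑ i : Fin k, C (c i / (n + 1 + i)) * X ^ (i : ℕ), degree_sum_fin_lt _, rfl⟩, ?_⟩
  rw [Finset.mul_sum, derivative_sum, Finset.mul_sum]
  refine Finset.sum_congr rfl fun i _ => ?_
  rw [show (X ^ (n + 1) * (C (c i / (n + 1 + i)) * X ^ (i : ℕ)) : ℝ[X]) =
    C (c i / (n + 1 + i)) * X ^ (n + i + 1) by ring, derivative_C_mul, derivative_X_pow,
    ← mul_assoc, Nat.add_sub_cancel, ← C_mul]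
  rw [show c i / (n + 1 + i) * ((n + i + 1 : ℕ) : ℝ) = c i by push_cast; field_simp; ring]
  ring

/-- The upper bound: an antiderivative of a negative binomial distribution function. -/
lemma exists_bernsteinNorm_le {n k : ℕ} (hn : 1 ≤ n) (hk : 1 ≤ k) :
    ∃ P ∈ incompletePoly n k, P.eval 1 ≠ 0 ∧
      bernsteinNorm P ≤ 2 * √((n : ℝ) / k + 1) * |P.eval 1| := by
  -- The factor x^n of P' must be the x^(m+1) of the distribution function.
  obtain ⟨m, rfl⟩ : ∃ m, n = m + 1 := ⟨n - 1, by omega⟩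
  obtain ⟨P, hP, hd⟩ := exists_derivative_eq_X_pow_mul (m + 1) k
    (S := ∑ i ∈ Finset.range k, C ((i + m).choose m : ℝ) * (1 - X) ^ i) (by
      refine mem_degreeLT.1 (Submodule.sum_mem _ fun i hi => mem_degreeLT.2 ?_)
      refine lt_of_le_of_lt (degree_le_of_natDegree_le (n := i) ?_)
        (by exact_mod_cast Finset.mem_range.1 hi)
      compute_degree)
  change derivative P = negBinomialCDF m k at hd
  have hk0 : (1 : ℝ) ≤ k := by exact_mod_cast hk
  have hP1 : P.eval 1 = k / (m + 1 + k) := by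
    have h0 : P.eval 0 = 0 := by
      obtain ⟨R, -, rfl⟩ := hP
      simp
    rw [← integral_negBinomialCDF m k, ← hd,
      intervalIntegral.integral_eq_sub_of_hasDerivAt (fun x _ => P.hasDerivAt x)
        ((derivative P).continuous.intervalIntegrable _ _), h0, sub_zero]
  have hpos : 0 < P.eval 1 := by rw [hP1]; positivity
  refine ⟨P, hP, hpos.ne', bernsteinNorm_le fun x hx => ?_⟩
  rw [hd, abs_of_nonneg (negBinomialCDF_nonneg m k hx), abs_of_pos hpos, hP1]
  have hQ0 := negBinomialCDF_nonneg m k hx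
  have hQ1 := negBinomialCDF_le_one m k hx
  have hQ2 := one_sub_mul_negBinomialCDF_le m k hx
  set q := (negBinomialCDF m k).eval x
  have hy0 : 0 ≤ 1 - x := by linarith [hx.2]
  have hx2 : 0 ≤ 1 - x ^ 2 := by nlinarith [hx.1]
  push_cast
  refine abs_le_of_sq_le_sq' ?_ (by positivity) |>.2
  rw [mul_pow, mul_pow, mul_pow, Real.sq_sqrt hx2, Real.sq_sqrt (by positivity)]
  have hb : q ^ 2 * (1 - x ^ 2) ≤ 2 * ((1 - x) * q) := by
    have : q ^ 2 * (1 - x ^ 2) = q * (1 + x) * ((1 - x) * q) := by ring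
    rw [this]
    gcongr
    nlinarith [hx.1, hx.2]
  have hrhs : 2 ^ 2 * (((m : ℝ) + 1) / k + 1) * (k / (m + 1 + k)) ^ 2 =
      4 * (k / (m + 1 + k)) := by
    field_simp
    norm_num
  rw [hrhs]
  -- After squaring, it remains that t = (1 - x)q satisfies t(m + 1 + k) ≤ 2k: add t(m + 1) ≤ k and
  -- tk ≤ k.
  refine hb.trans ?_
  rw [← mul_div_assoc, le_div_iff₀ (by positivity)]
  have h1 : (1 - x) * q ≤ 1 := by nlinarith [hx.1]
  have h2 : (1 - x) * q * (m + 1) ≤ k := (le_div_iff₀ (by positivity)).1 hQ2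
  nlinarith

theorem theorem2p2 :
    ∃ c₂ : ℝ, 0 < c₂ ∧ ∀ n k : ℕ, 1 ≤ n → 1 ≤ k →
      ∃ m₁ m₂ : ℝ,
        IsLeast (variationQuotients (incompletePoly n k)) m₁ ∧
        IsLeast (endpointQuotients (incompletePoly n k)) m₂ ∧
        IsGLB (variationQuotients (incompletePolyExact n k)) m₁ ∧
        IsGLB (endpointQuotients (incompletePolyExact n k)) m₂ ∧
        (1 / 6 : ℝ) * √((n : ℝ) / (k : ℝ)) ≤ m₁ ∧
        m₁ ≤ m₂ ∧
        m₂ ≤ c₂ * √((n : ℝ) / (k : ℝ) + 1) := by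
  refine ⟨2, two_pos, fun n k hn hk => ?_⟩
  obtain ⟨m₁, hm₁, hg₁⟩ := exists_min_variationQuotients n hk
  obtain ⟨m₂, hm₂, hg₂⟩ := exists_min_endpointQuotients n hk
  have zero_of_mem : ∀ P ∈ incompletePoly n k, P.eval 0 = 0 := by
    rintro _ ⟨R, -, rfl⟩
    simp
  refine ⟨m₁, m₂, hm₁, hm₂, hg₁, hg₂, ?_, ?_, ?_⟩
  · obtain ⟨P, ⟨hP, hP0⟩, rfl⟩ := hm₁.1
    exact (le_div_iff₀ (totalVar_pos (zero_of_mem P hP) hP0)).2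
      (totalVar_mul_sqrt_le hn hk hP hP0)
  · obtain ⟨P, ⟨hP, hP1⟩, rfl⟩ := hm₂.1
    have hP0 : P ≠ 0 := by
      rintro rfl
      simp at hP1
    refine (hm₁.2 ⟨P, ⟨hP, hP0⟩, rfl⟩).trans ?_
    exact div_le_div_of_nonneg_left (bernsteinNorm_nonneg P) (abs_pos.2 hP1)
      (abs_eval_one_le_totalVar (zero_of_mem P hP))
  · obtain ⟨P, hP, hP1, hle⟩ := exists_bernsteinNorm_le hn hk
    exact (hm₂.2 ⟨P, ⟨hP, hP1⟩, rfl⟩).trans ((div_le_iff₀ (abs_pos.2 hP1)).2 hle)
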